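/- Let $V$ be a finite-dimensional real inner product space and $\Phi\subset V$ an irreducible, reduced, crystallographic root system, with coroots $\alpha^\vee=2\alpha/\langle\alpha,\alpha\rangle$, Weyl group $W$, simple roots $\alpha_1,\dots,\alpha_n$, fundamental weights $\omega_1,\dots,\omega_n$ (so $\langle\omega_i,\alpha_j^\vee\rangle=\delta_{ij}$), root lattice $Q=\mathrm{Span}_{\mathbb Z}(\Phi)$ and weight lattice $P=\{v\in V:\langle v,\alpha^\vee\rangle\in\mathbb Z\text{ for all }\alpha\in\Phi\}$. A root is long if its length is maximal among all roots, and short otherwise. Let $\lambda=\sum_i c_i\omega_i$ with $c_i\in\mathbb Z_{\ge 0}$ be a dominant weight, and let $\Pi^Q(\lambda)=\mathrm{ConvexHull}(W\lambda)\cap(Q+\lambda)$ be its discrete permutohedron. For $\alpha\in\Phi$, an $\alpha$-traverse of length $\ell\in\mathbb Z_{\ge 0}$ in $\Pi^Q(\lambda)$ is a set $\{\mu,\mu-\alpha,\dots,\mu-\ell\alpha\}\subseteq\Pi^Q(\lambda)$ with $\mu\in P$, $\mu+\alpha\notin\Pi^Q(\lambda)$ and $\mu-(\ell+1)\alpha\notin\Pi^Q(\lambda)$.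 Put $$\mathbf l_\lambda(\alpha)=\min\{\ell:\text{there is an }\alpha\text{-traverse of length }\ell\text{ in }\Pi^Q(\lambda)\},\qquad \mathbf m_\lambda(\alpha)=\min\{c_i:\alpha\in W(\alpha_i)\}.$$ Call $\Phi$ simply laced if $\langle\alpha_i,\alpha_j^\vee\rangle\langle\alpha_j,\alpha_i^\vee\rangle\in\{0,1\}$ for all $i\ne j$. If $\Phi$ is simply laced, no weight is funny. If $\Phi$ is not simply laced, there are a unique long simple root $\alpha_l$ and a unique short simple root $\alpha_s$ with $\langle\alpha_l,\alpha_s^\vee\rangle\neq0$, and $\lambda$ is called funny if $c_s=0$, $c_l\ge1$, and $c_i\ge c_l$ for all $i$ such that $\alpha_i$ is long. Theorem. For every $\alpha\in\Phi$ both minima are over nonempty sets, and $$\mathbf l_\lambda(\alpha)=\begin{cases}\mathbf m_\lambda(\alpha)-1&\text{if }\alpha\text{ is long and }\lambda\text{ is funny},\\ \mathbf m_\lambda(\alpha)&\text{otherwise.}\end{cases}$$ -/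

import Mathlib

/-!
Root systems are Mathlib's `RootPairing`s `Φ` over `ℝ` (finite, spanning, reduced, crystallographic),
with roots in a real inner product space `V`. Simple roots are given by a base `b`;
`Φ.weylGroup` acts linearly on `V`.
-/

noncomputable section

namespace TraverseLength

variable {ι V N : Type*} [NormedAddCommGroup V] [InnerProductSpace ℝ V]
  [AddCommGroup N] [Module ℝ N]

/-- The coroots are the covectors `α^∨ = 2α / ⟨α, α⟩` for the inner product of `V`: pairing `v`
with the coroot of `α` gives `2⟨v, α⟩ / ⟨α, α⟩`. Thus the reflections of `Φ` are the orthogonal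
reflections in the roots. -/
def IsEuclidean (Φ : RootPairing ι ℝ V N) : Prop :=
  ∀ (a : ι) (v : V), Φ.toLinearMap v (Φ.coroot a) =
    2 * inner ℝ v (Φ.root a) / inner ℝ (Φ.root a) (Φ.root a)

/-- The root lattice `Q`. -/
def rootLattice (Φ : RootPairing ι ℝ V N) : AddSubgroup V :=
  AddSubgroup.closure (Set.range Φ.root)

/-- The weight lattice `P` (as a set): the vectors pairing integrally with all coroots. -/
def weightLattice (Φ : RootPairing ι ℝ V N) : Set V :=
  {v | ∀ a : ι, ∃ z : ℤ, Φ.toLinearMap v (Φ.coroot a) = z}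

/-- The permutohedron `Π(v)`: the convex hull of the Weyl group orbit of `v`. -/
def permutohedron (Φ : RootPairing ι ℝ V N) (v : V) : Set V :=
  convexHull ℝ (MulAction.orbit Φ.weylGroup v)

/-- The discrete permutohedron `Π^Q(v) = Π(v) ∩ (Q + v)`. -/
def discretePermutohedron (Φ : RootPairing ι ℝ V N) (v : V) : Set V :=
  {u | u ∈ permutohedron Φ v ∧ u - v ∈ rootLattice Φ}

/-- The string `{μ, μ - α, …, μ - ℓα}`, where `α` is the root with index `a`. -/
def rootString (Φ : RootPairing ι ℝ V N) (a : ι) (μ : V) (ℓ : ℕ) : Set V :=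
  {u | ∃ k : ℕ, k ≤ ℓ ∧ u = μ - k • Φ.root a}

/-- The `α`-string of length `ℓ` starting at the weight `μ` is an `α`-traverse in `Π^Q(lam)`: it is
contained in `Π^Q(lam)` and can be extended at neither end. -/
def IsTraverse (Φ : RootPairing ι ℝ V N) (lam : V) (a : ι) (μ : V) (ℓ : ℕ) : Prop :=
  μ ∈ weightLattice Φ ∧
  rootString Φ a μ ℓ ⊆ discretePermutohedron Φ lam ∧
  μ + Φ.root a ∉ discretePermutohedron Φ lam ∧
  μ - (ℓ + 1) • Φ.root a ∉ discretePermutohedron Φ lam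

/-- The set of lengths of `α`-traverses in `Π^Q(lam)`. -/
def traverseLengths (Φ : RootPairing ι ℝ V N) (lam : V) (a : ι) : Set ℕ :=
  {ℓ | ∃ μ : V, IsTraverse Φ lam a μ ℓ}

/-- The traverse length `l_lam(α)`: the minimal length of an `α`-traverse in `Π^Q(lam)`. -/
def traverseLength (Φ : RootPairing ι ℝ V N) (lam : V) (a : ι) : ℕ :=
  sInf (traverseLengths Φ lam a)

/-- A root is long if its length is maximal among all roots; otherwise it is short. -/
def IsLong (Φ : RootPairing ι ℝ V N) (a : ι) : Prop :=
  ∀ b : ι, ‖Φ.root b‖ ≤ ‖Φ.root a‖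

section Base

variable {Φ : RootPairing ι ℝ V N} (b : Φ.Base)

/-- The fundamental weights `ω_i`: the basis of `V` dual to the simple coroots. -/
def fundamentalWeight [Φ.IsRootSystem] (i : b.support) : V :=
  Φ.toPerfPair.symm (b.toCoweightBasis.coord i)

theorem fundamentalWeight_coroot [Φ.IsRootSystem] [DecidableEq ι] (i j : b.support) :
    Φ.toLinearMap (fundamentalWeight b i) (Φ.coroot j) = if i = j then 1 else 0 := by
  have h : Φ.toLinearMap (fundamentalWeight b i) = b.toCoweightBasis.coord i :=
    Φ.toPerfPair.apply_symm_apply (b.toCoweightBasis.coord i)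
  rw [h]
  simp [Finsupp.single_apply, eq_comm]

/-- The dominant weight `∑ c_i ω_i` with coordinates `c_i ∈ ℕ`. -/
def dominantWeight [Φ.IsRootSystem] (c : b.support → ℕ) : V :=
  ∑ i, c i • fundamentalWeight b i

/-- `Φ` is simply laced: the Dynkin diagram has only single edges (hence no arrows), i.e.
`⟨α_i, α_j^∨⟩⟨α_j, α_i^∨⟩ ∈ {0, 1}` for distinct simple roots. -/
def IsSimplyLaced : Prop :=
  ∀ i j : b.support, i ≠ j → Φ.coxeterWeight i j = 0 ∨ Φ.coxeterWeight i j = 1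

/-- The dominant weight `∑ c_i ω_i` is funny: `Φ` is not simply laced and, with `α_l`, `α_s` the
(unique) long and short simple roots such that `⟨α_l, α_s^∨⟩ ≠ 0`, one has `c_s = 0`, `c_l ≥ 1`,
and `c_i ≥ c_l` for all long simple roots `α_i`. -/
def IsFunny (c : b.support → ℕ) : Prop :=
  ¬ IsSimplyLaced b ∧
  ∃ l s : b.support, IsLong Φ l ∧ ¬ IsLong Φ s ∧ Φ.pairing l s ≠ 0 ∧
    c s = 0 ∧ 1 ≤ c l ∧ ∀ i : b.support, IsLong Φ i → c l ≤ c i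

/-- The set `{c_i : α ∈ W(α_i)}`. -/
def conjugateCoeffs (c : b.support → ℕ) (a : ι) : Set ℕ :=
  {m | ∃ i : b.support, Φ.root a ∈ MulAction.orbit Φ.weylGroup (Φ.root i) ∧ c i = m}

/-- `m_λ(α) = min {c_i : α ∈ W(α_i)}`, for `λ = ∑ c_i ω_i`. -/
def minCoeff (c : b.support → ℕ) (a : ι) : ℕ :=
  sInf (conjugateCoeffs b c a)

end Base

end TraverseLength

end

open TraverseLength

noncomputable section

namespace TraverseLength

variable {ι V N : Type*} [NormedAddCommGroup V] [InnerProductSpace ℝ V]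
  [AddCommGroup N] [Module ℝ N] {Φ : RootPairing ι ℝ V N}

/-! ### The inner product as an invariant form -/

/-! Since `Π^Q(λ)` is `W`-stable and closed under filling in root strings, `s_α` reverses every
`α`-traverse. A traverse with top `μ` therefore has length `⟨μ, α^∨⟩`, and the problem is to
minimise this pairing over `μ ∈ Π^Q(λ)` with `μ + α ∉ Π^Q(λ)`.

Upper bound: up to conjugation `α` is simple. The top `λ` gives the length `c_i`
(`conjugateCoeffs_subset`); for funny `λ`, the top `λ - α_l - α_s` gives `c_l - 1`
(`pred_mem_traverseLengths`).

Lower bound: a point lies in the permutohedron as soon as, for all `g ∈ W`, `λ - gv` has nonnegative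
simple-root coordinates (`exists_coord_sub_neg`). Apply this to `μ + α`, and among all violations
choose one for which the root `x = gα` has least height. Then `x` pairs nonpositively with every
simple root except one, `α_i`, and only coordinate `i` is violated (`exists_antidominant`).
Expanding `⟨gμ, x^∨⟩` in coordinates yields `ℓ ≥ S - 2 + p`, with `S = ⟨λ, x^∨⟩` and `p = ⟨α_i, x^∨⟩
≥ 1`, and `ℓ ≥ S` if `α_i` has coefficient `1` in `x` (`exists_bounds`). The support of `x` contains
a simple root conjugate to `x`, so `S ≥ m_λ(α)`. Hence `ℓ ≥ m_λ(α) - 1`, and the equality case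
forces `α` to be long and `λ` to be funny (`minCoeff_le`). -/

theorem inner_root_pos (Φ : RootPairing ι ℝ V N) (a : ι) :
    0 < inner ℝ (Φ.root a) (Φ.root a) :=
  real_inner_self_pos.mpr (Φ.ne_zero a)

theorem IsEuclidean.apply_mul (hΦ : IsEuclidean Φ) (a : ι) (v : V) :
    Φ.toLinearMap v (Φ.coroot a) * inner ℝ (Φ.root a) (Φ.root a) =
      2 * inner ℝ v (Φ.root a) := by
  rw [hΦ a v, div_mul_cancel₀ _ (inner_root_pos Φ a).ne']

theorem reflection_eq (a : ι) (v : V) :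
    Φ.reflection a v = v - Φ.toLinearMap v (Φ.coroot a) • Φ.root a := by
  rw [RootPairing.reflection_apply]; rfl

theorem IsEuclidean.inner_reflection (hΦ : IsEuclidean Φ) (a : ι) (u v : V) :
    inner ℝ (Φ.reflection a u) (Φ.reflection a v) = inner ℝ u v := by
  rw [reflection_eq, reflection_eq]
  simp only [inner_sub_left, inner_sub_right, real_inner_smul_left, real_inner_smul_right]
  have h1 := hΦ.apply_mul a u
  have h2 := hΦ.apply_mul a v
  rw [real_inner_comm v (Φ.root a)]
  linear_combination
    (Φ.toLinearMap u (Φ.coroot a)) / 2 * h2 + (Φ.toLinearMap v (Φ.coroot a)) / 2 * h1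

/-- The inner product as an invariant form of the root system. -/
def IsEuclidean.form (hΦ : IsEuclidean Φ) : Φ.InvariantForm where
  form := innerₗ V
  symm := ⟨fun x y => by simp [real_inner_comm]⟩
  ne_zero i := by simpa using (Φ.ne_zero i)
  isOrthogonal_reflection i := fun x y => by simpa using hΦ.inner_reflection i x y

theorem IsEuclidean.inner_smul_smul (hΦ : IsEuclidean Φ) (g : Φ.weylGroup) (u v : V) :
    inner ℝ (g • u) (g • v) = inner ℝ u v :=
  RootPairing.InvariantForm.apply_weylGroup_smul Φ (B := hΦ.form) g u v

theorem IsEuclidean.apply_smul_coroot (hΦ : IsEuclidean Φ) (g : Φ.weylGroup) (v : V) (a : ι) :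
    Φ.toLinearMap (g • v) (Φ.coroot (Φ.weylGroupToPerm g a)) =
      Φ.toLinearMap v (Φ.coroot a) := by
  rw [hΦ, hΦ, ← Φ.weylGroup_apply_root, hΦ.inner_smul_smul, hΦ.inner_smul_smul]

theorem ofIdx_smul_eq (a : ι) (v : V) :
    RootPairing.weylGroup.ofIdx Φ a • v =
      v - Φ.toLinearMap v (Φ.coroot a) • Φ.root a :=
  reflection_eq a v

theorem weylGroup_smul_real (g : Φ.weylGroup) (t : ℝ) (v : V) : g • (t • v) = t • (g • v) :=
  smul_comm _ _ _

theorem weylGroup_induction {p : Φ.weylGroup → Prop}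
    (ofIdx : ∀ a, p (RootPairing.weylGroup.ofIdx Φ a)) (one : p 1)
    (mul : ∀ g h, p g → p h → p (g * h)) (g : Φ.weylGroup) : p g := by
  obtain ⟨g, hg⟩ := g
  induction hg using RootPairing.weylGroup.induction with
  | mem i => exact ofIdx i
  | one => exact one
  | mul x y hx hy h1 h2 => exact mul ⟨x, hx⟩ ⟨y, hy⟩ h1 h2

/-! ### The discrete permutohedron -/

/-- A reflection moves a weight by an integer multiple of a root, so `W` acts trivially on `P / Q`.
This is what makes `Π^Q(λ)`, and not only its convex hull, `W`-stable. -/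
theorem weightLattice_sub_mem_rootLattice [Φ.IsCrystallographic] (g : Φ.weylGroup) :
    ∀ v ∈ weightLattice Φ, g • v ∈ weightLattice Φ ∧ g • v - v ∈ rootLattice Φ := by
  induction g using weylGroup_induction with
  | ofIdx a =>
    intro v hv
    obtain ⟨z, hz⟩ := hv a
    rw [ofIdx_smul_eq, hz]
    constructor
    · intro c
      obtain ⟨w, hw⟩ := hv c
      refine ⟨w - z * Φ.pairingIn ℤ a c, ?_⟩
      have h : Φ.toLinearMap (Φ.root a) (Φ.coroot c) = (Φ.pairingIn ℤ a c : ℝ) := by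
        rw [Φ.root_coroot_eq_pairing, ← Φ.algebraMap_pairingIn ℤ]; rfl
      simp only [map_sub, map_smul, LinearMap.sub_apply, LinearMap.smul_apply, hw, h]
      push_cast
      rfl
    · have h : v - (z : ℝ) • Φ.root a - v = -(z • Φ.root a) := by
        rw [Int.cast_smul_eq_zsmul]; abel
      rw [h]
      exact neg_mem (zsmul_mem (AddSubgroup.subset_closure (Set.mem_range_self a)) z)
  | one => intro v hv; simpa using hv
  | mul g h hg hh =>
    intro v hv
    obtain ⟨h1, h2⟩ := hh v hv
    obtain ⟨h3, h4⟩ := hg _ h1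
    rw [mul_smul]
    refine ⟨h3, ?_⟩
    have := add_mem h4 h2
    rwa [sub_add_sub_cancel] at this

theorem add_mem_weightLattice {u v : V} (hu : u ∈ weightLattice Φ) (hv : v ∈ weightLattice Φ) :
    u + v ∈ weightLattice Φ := by
  intro a
  obtain ⟨y, hy⟩ := hu a
  obtain ⟨z, hz⟩ := hv a
  exact ⟨y + z, by simp [hy, hz]⟩

theorem rootLattice_subset_weightLattice [Φ.IsCrystallographic] {v : V}
    (hv : v ∈ rootLattice Φ) : v ∈ weightLattice Φ := by
  induction hv using AddSubgroup.closure_induction with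
  | mem x hx =>
    obtain ⟨a, rfl⟩ := hx
    intro c
    exact ⟨Φ.pairingIn ℤ a c, by
      rw [Φ.root_coroot_eq_pairing, ← Φ.algebraMap_pairingIn ℤ]; rfl⟩
  | zero => intro a; exact ⟨0, by simp⟩
  | add x y _ _ hx hy => exact add_mem_weightLattice hx hy
  | neg x _ hx =>
    intro a
    obtain ⟨z, hz⟩ := hx a
    exact ⟨-z, by simp [hz]⟩

theorem mem_weightLattice_of_mem_discretePermutohedron [Φ.IsCrystallographic] {lam u : V}
    (hlam : lam ∈ weightLattice Φ) (hu : u ∈ discretePermutohedron Φ lam) :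
    u ∈ weightLattice Φ := by
  have := add_mem_weightLattice (rootLattice_subset_weightLattice hu.2) hlam
  rwa [sub_add_cancel] at this

theorem smul_mem_permutohedron {lam u : V} (g : Φ.weylGroup) (hu : u ∈ permutohedron Φ lam) :
    g • u ∈ permutohedron Φ lam := by
  have h : Φ.weylGroupRootRep g '' convexHull ℝ (MulAction.orbit Φ.weylGroup lam) ⊆
      convexHull ℝ (MulAction.orbit Φ.weylGroup lam) := by
    rw [LinearMap.image_convexHull]
    refine convexHull_mono ?_
    rintro _ ⟨v, hv, rfl⟩
    exact MulAction.mem_orbit_of_mem_orbit g hv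
  exact h ⟨u, hu, rfl⟩

theorem smul_mem_discretePermutohedron [Φ.IsCrystallographic] {lam u : V}
    (hlam : lam ∈ weightLattice Φ) (g : Φ.weylGroup) (hu : u ∈ discretePermutohedron Φ lam) :
    g • u ∈ discretePermutohedron Φ lam := by
  refine ⟨smul_mem_permutohedron g hu.1, ?_⟩
  have := add_mem (weightLattice_sub_mem_rootLattice g u
    (mem_weightLattice_of_mem_discretePermutohedron hlam hu)).2 hu.2
  rwa [sub_add_sub_cancel] at this

theorem smul_mem_discretePermutohedron_iff [Φ.IsCrystallographic] {lam u : V}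
    (hlam : lam ∈ weightLattice Φ) (g : Φ.weylGroup) :
    g • u ∈ discretePermutohedron Φ lam ↔ u ∈ discretePermutohedron Φ lam := by
  refine ⟨fun h => ?_, smul_mem_discretePermutohedron hlam g⟩
  simpa using smul_mem_discretePermutohedron hlam g⁻¹ h

theorem self_mem_discretePermutohedron (lam : V) : lam ∈ discretePermutohedron Φ lam :=
  ⟨subset_convexHull ℝ _ (MulAction.mem_orbit_self lam), by simp⟩

/-- Discrete permutohedra contain the lattice points between two of their points on a line in a
root direction. -/
theorem sub_zsmul_mem_discretePermutohedron {lam u : V} {a : ι} {x y z : ℤ}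
    (hx : u - x • Φ.root a ∈ discretePermutohedron Φ lam)
    (hz : u - z • Φ.root a ∈ discretePermutohedron Φ lam) (hxy : x ≤ y) (hyz : y ≤ z) :
    u - y • Φ.root a ∈ discretePermutohedron Φ lam := by
  constructor
  · rcases (hxy.trans hyz).eq_or_lt with h | h
    · obtain rfl : y = x := by omega
      exact hx.1
    have hpos : (0 : ℝ) < z - x := by exact_mod_cast sub_pos.mpr h
    have hconv : Convex ℝ (permutohedron Φ lam) := convex_convexHull ℝ _
    have h1 : (0 : ℝ) ≤ (z - y) / (z - x) :=
      div_nonneg (by exact_mod_cast sub_nonneg.mpr hyz) hpos.le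
    have h2 : (0 : ℝ) ≤ (y - x) / (z - x) :=
      div_nonneg (by exact_mod_cast sub_nonneg.mpr hxy) hpos.le
    have h3 : ((z : ℝ) - y) / (z - x) + (y - x) / (z - x) = 1 := by
      field_simp; ring
    have := hconv hx.1 hz.1 h1 h2 h3
    convert this using 1
    simp only [← Int.cast_smul_eq_zsmul ℝ]
    match_scalars
    · linarith
    · field_simp; ring
  · have h := sub_mem hx.2 (zsmul_mem (AddSubgroup.subset_closure (Set.mem_range_self a) :
      Φ.root a ∈ rootLattice Φ) (y - x))
    convert h using 1
    module

/-! ### Traverses -/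

/-- The reflection `s_α` sends `μ` to `μ - ⟨μ, α^∨⟩α` and `μ + α` to the point just beyond it, so
the bottom of the string is the mirror image of the top. -/
theorem exists_isTraverse [Φ.IsCrystallographic] {lam μ : V} {a : ι}
    (hlam : lam ∈ weightLattice Φ) (h1 : μ ∈ discretePermutohedron Φ lam)
    (h2 : μ + Φ.root a ∉ discretePermutohedron Φ lam) :
    ∃ ℓ : ℕ, Φ.toLinearMap μ (Φ.coroot a) = ℓ ∧ IsTraverse Φ lam a μ ℓ := by
  have hμ := mem_weightLattice_of_mem_discretePermutohedron hlam h1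
  obtain ⟨z, hz⟩ := hμ a
  set s := RootPairing.weylGroup.ofIdx Φ a
  have hs : s • μ = μ - z • Φ.root a := by
    rw [ofIdx_smul_eq, hz, Int.cast_smul_eq_zsmul]
  have hs' : s • (μ + Φ.root a) = μ - (z + 1) • Φ.root a := by
    rw [smul_add, hs, ofIdx_smul_eq, Φ.root_coroot_eq_pairing, Φ.pairing_same]
    module
  have hsμ : μ - z • Φ.root a ∈ discretePermutohedron Φ lam := by
    rw [← hs]; exact smul_mem_discretePermutohedron hlam s h1
  have h0 : μ - (0 : ℤ) • Φ.root a ∈ discretePermutohedron Φ lam := by simpa using h1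
  -- If `z` were negative, `μ + α` would lie between `μ` and its reflection, hence in `Π^Q(λ)`.
  have hz0 : 0 ≤ z := by
    by_contra! hneg
    refine h2 ?_
    have := sub_zsmul_mem_discretePermutohedron (y := -1) hsμ h0 (by omega) (by omega)
    simpa using this
  lift z to ℕ using hz0
  refine ⟨z, by simpa using hz, hμ, ?_, h2, ?_⟩
  · rintro _ ⟨k, hk, rfl⟩
    have := sub_zsmul_mem_discretePermutohedron (y := k) h0 hsμ (by omega) (by omega)
    simpa using this
  · intro h
    rw [← smul_mem_discretePermutohedron_iff hlam s, hs'] at h2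
    exact h2 (by exact_mod_cast h)

theorem IsTraverse.apply_coroot [Φ.IsCrystallographic] {lam μ : V} {a : ι} {ℓ : ℕ}
    (hlam : lam ∈ weightLattice Φ) (h : IsTraverse Φ lam a μ ℓ) :
    μ ∈ discretePermutohedron Φ lam ∧ Φ.toLinearMap μ (Φ.coroot a) = ℓ := by
  obtain ⟨-, h2, h3, h4⟩ := h
  have h1 : μ ∈ discretePermutohedron Φ lam := h2 ⟨0, by omega, by simp⟩
  refine ⟨h1, ?_⟩
  obtain ⟨k, hk, -, hk2, -, hk4⟩ := exists_isTraverse hlam h1 h3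
  rw [hk]
  rcases lt_trichotomy k ℓ with hlt | rfl | hlt
  · exact absurd (h2 ⟨k + 1, hlt, rfl⟩) hk4
  · rfl
  · exact absurd (hk2 ⟨ℓ + 1, hlt, rfl⟩) h4

/-! ### Coordinates with respect to the simple roots -/

theorem coord_simpleRoot [Φ.IsRootSystem] [DecidableEq ι] (b : Φ.Base) (i j : b.support) :
    b.toWeightBasis.coord i (Φ.root j) = if i = j then 1 else 0 := by
  simp [Finsupp.single_apply, eq_comm]

theorem sum_coord_smul_root [Φ.IsRootSystem] (b : Φ.Base) (v : V) :
    ∑ k : b.support, b.toWeightBasis.coord k v • Φ.root k = v := by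
  simpa using b.toWeightBasis.sum_repr v

theorem exists_int_coord_root [Φ.IsRootSystem] (b : Φ.Base) (a : ι) :
    ∃ f : ι → ℤ, (0 < f ∨ f < 0) ∧
      (∀ k : b.support, b.toWeightBasis.coord k (Φ.root a) = f k) ∧
      b.height a = ∑ k : b.support, f k := by
  classical
  obtain ⟨f, -, h1, h2⟩ := b.exists_root_eq_sum_int a
  refine ⟨f, h1, fun k => ?_, ?_⟩
  · rw [h2, map_sum, ← Finset.sum_coe_sort]
    simp only [map_zsmul, coord_simpleRoot]
    simp
  · rw [RootPairing.Base.height_eq_sum h2, ← Finset.sum_coe_sort]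

theorem exists_nat_coord_root [Φ.IsRootSystem] (b : Φ.Base) {a : ι} (ha : b.IsPos a) :
    ∃ f : b.support → ℕ, (∀ k, b.toWeightBasis.coord k (Φ.root a) = f k) ∧
      b.height a = ∑ k, (f k : ℤ) := by
  obtain ⟨f, h1, h2, h3⟩ := exists_int_coord_root b a
  have hf : 0 < f := by
    refine h1.resolve_right fun h => ?_
    rw [RootPairing.Base.isPos_iff, h3] at ha
    exact absurd ha (not_lt.mpr (Finset.sum_nonpos fun k _ => h.le k))
  refine ⟨fun k => (f k).toNat, fun k => ?_, ?_⟩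
  · rw [h2 k]
    exact_mod_cast (Int.toNat_of_nonneg (hf.le k)).symm
  · rw [h3]
    exact Finset.sum_congr rfl fun k _ => (Int.toNat_of_nonneg (hf.le k)).symm

theorem coord_root_nonneg [Φ.IsRootSystem] (b : Φ.Base) {a : ι} (ha : b.IsPos a)
    (k : b.support) : 0 ≤ b.toWeightBasis.coord k (Φ.root a) := by
  obtain ⟨f, h, -⟩ := exists_nat_coord_root b ha
  rw [h]; positivity

theorem isPos_of_coord_pos [Φ.IsRootSystem] (b : Φ.Base) {a : ι} {k : b.support}
    (h : 0 < b.toWeightBasis.coord k (Φ.root a)) : b.IsPos a := by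
  obtain ⟨f, h1, h2, h3⟩ := exists_int_coord_root b a
  rw [h2] at h
  have h : 0 < f k := by exact_mod_cast h
  have hf : 0 < f := h1.resolve_right fun h' => absurd (h'.le k) (not_le.mpr h)
  rw [RootPairing.Base.isPos_iff', h3]
  exact Finset.sum_nonneg fun k _ => hf.le k

theorem height_eq_sum_coord [Φ.IsRootSystem] (b : Φ.Base) (a : ι) :
    (b.height a : ℝ) = ∑ k, b.toWeightBasis.coord k (Φ.root a) := by
  obtain ⟨f, -, h2, h3⟩ := exists_int_coord_root b a
  rw [h3]
  push_cast
  exact Finset.sum_congr rfl fun k _ => (h2 k).symm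

/-! ### Words in the simple reflections -/

/-- The product of the simple reflections listed in `l`. -/
def simpleWord (b : Φ.Base) (l : List b.support) : V ≃ₗ[ℝ] V :=
  (l.map fun i => Φ.reflection i).prod

theorem simpleWord_append (b : Φ.Base) (l m : List b.support) :
    simpleWord b (l ++ m) = simpleWord b l * simpleWord b m := by
  simp [simpleWord]

theorem simpleWord_cons (b : Φ.Base) (i : b.support) (l : List b.support) :
    simpleWord b (i :: l) = Φ.reflection i * simpleWord b l := by
  simp [simpleWord]

theorem simpleWord_nil (b : Φ.Base) : simpleWord b [] = 1 := rfl

theorem simpleWord_singleton (b : Φ.Base) (i : b.support) :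
    simpleWord b [i] = Φ.reflection i := by
  simp [simpleWord]

theorem exists_simpleWord_root (b : Φ.Base) (l : List b.support) (a : ι) :
    ∃ c, simpleWord b l (Φ.root a) = Φ.root c := by
  induction l with
  | nil => exact ⟨a, rfl⟩
  | cons i l ih =>
    obtain ⟨c, hc⟩ := ih
    refine ⟨Φ.reflectionPerm i c, ?_⟩
    rw [simpleWord_cons, LinearEquiv.mul_apply, hc, Φ.root_reflectionPerm]

theorem IsEuclidean.inner_simpleWord (hΦ : IsEuclidean Φ) (b : Φ.Base) (l : List b.support)
    (u v : V) : inner ℝ (simpleWord b l u) (simpleWord b l v) = inner ℝ u v := by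
  induction l with
  | nil => rfl
  | cons i l ih =>
    rw [simpleWord_cons, LinearEquiv.mul_apply, LinearEquiv.mul_apply, hΦ.inner_reflection, ih]

theorem IsEuclidean.simpleWord_mul_reflection (hΦ : IsEuclidean Φ) (b : Φ.Base)
    {l : List b.support} {a c : ι} (h : simpleWord b l (Φ.root a) = Φ.root c) :
    simpleWord b l * Φ.reflection a = Φ.reflection c * simpleWord b l := by
  ext v
  rw [LinearEquiv.mul_apply, LinearEquiv.mul_apply, reflection_eq, reflection_eq, map_sub,
    map_smul, h, hΦ, hΦ, ← h, hΦ.inner_simpleWord, hΦ.inner_simpleWord]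

/-- The exchange property. -/
theorem IsEuclidean.exists_shorter_simpleWord [Finite ι] [Φ.IsCrystallographic] [Φ.IsReduced]
    (hΦ : IsEuclidean Φ) (b : Φ.Base) (k : b.support) (l : List b.support) {c : ι}
    (hl : simpleWord b l (Φ.root k) = Φ.root c) (hc : ¬ b.IsPos c) :
    ∃ m : List b.support, m.length + 1 ≤ l.length ∧
      simpleWord b l * Φ.reflection k = simpleWord b m := by
  induction l generalizing c with
  | nil =>
    rw [simpleWord_nil, LinearEquiv.coe_one, id] at hl
    obtain rfl := Φ.root.injective hl
    exact absurd (RootPairing.Base.isPos_of_mem_support k.2) hc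
  | cons i l ih =>
    obtain ⟨d, hd⟩ := exists_simpleWord_root b l k
    rw [simpleWord_cons, LinearEquiv.mul_apply, hd, ← Φ.root_reflectionPerm] at hl
    obtain rfl := Φ.root.injective hl
    by_cases hpos : b.IsPos d
    · have hdi : d = i := by
        by_contra hne
        exact hc (hpos.reflectionPerm i.2 hne)
      refine ⟨l, le_rfl, ?_⟩
      rw [simpleWord_cons, mul_assoc, hΦ.simpleWord_mul_reflection b hd, hdi, ← mul_assoc]
      have : Φ.reflection (i : ι) * Φ.reflection i = 1 := by ext v; simp
      rw [this, one_mul]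
    · obtain ⟨m, hm, h⟩ := ih hd hpos
      exact ⟨i :: m, by simpa using hm, by rw [simpleWord_cons, mul_assoc, h, simpleWord_cons]⟩

theorem exists_reflection_eq_simpleWord [Finite ι] [Φ.IsCrystallographic] [Φ.IsReduced]
    (b : Φ.Base) (a : ι) : ∃ l, Φ.reflection a = simpleWord b l := by
  have key (i j : ι) : Φ.reflection (Φ.reflectionPerm j i) =
      Φ.reflection j * Φ.reflection i * Φ.reflection j := by
    ext v
    rw [Φ.reflection_reflectionPerm]
  refine b.induction_reflect a (p := fun a => ∃ l, Φ.reflection a = simpleWord b l) ?_ ?_ ?_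
  · rintro i ⟨l, hl⟩
    refine ⟨l ++ l ++ l, ?_⟩
    rw [key, hl, simpleWord_append, simpleWord_append]
  · intro i hi
    exact ⟨[⟨i, hi⟩], by rw [simpleWord_singleton]⟩
  · rintro i j ⟨l, hl⟩ hj
    refine ⟨[⟨j, hj⟩] ++ l ++ [⟨j, hj⟩], ?_⟩
    rw [key, hl, simpleWord_append, simpleWord_append, simpleWord_singleton]

theorem exists_smul_eq_simpleWord [Finite ι] [Φ.IsCrystallographic] [Φ.IsReduced]
    (b : Φ.Base) (g : Φ.weylGroup) : ∃ l, ∀ v : V, g • v = simpleWord b l v := by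
  induction g using weylGroup_induction with
  | ofIdx a =>
    obtain ⟨l, hl⟩ := exists_reflection_eq_simpleWord b a
    exact ⟨l, fun v => by rw [← hl]; rfl⟩
  | one => exact ⟨[], fun v => by rw [one_smul]; rfl⟩
  | mul g h hg hh =>
    obtain ⟨l, hl⟩ := hg
    obtain ⟨m, hm⟩ := hh
    exact ⟨l ++ m, fun v => by rw [mul_smul, hm, hl, simpleWord_append]; rfl⟩

/-! ### Inequalities for permutohedra -/

/-- Split off the last letter: `λ - w s_i λ = (λ - wλ) + ⟨λ, α_i^∨⟩ wα_i`. If `wα_i` is positive,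
both summands are nonnegative; otherwise the exchange property replaces `w s_i` by a shorter word.
-/
theorem IsEuclidean.coord_sub_simpleWord_nonneg [Finite ι] [Φ.IsRootSystem]
    [Φ.IsCrystallographic] [Φ.IsReduced]
    (hΦ : IsEuclidean Φ) (b : Φ.Base) {lam : V}
    (hdom : ∀ k : b.support, 0 ≤ Φ.toLinearMap lam (Φ.coroot k)) (k : b.support) (n : ℕ) :
    ∀ l : List b.support, l.length = n →
      0 ≤ b.toWeightBasis.coord k (lam - simpleWord b l lam) := by
  induction n using Nat.strong_induction_on with
  | _ n ih =>
    intro l hl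
    rcases List.eq_nil_or_concat l with rfl | ⟨m, i, rfl⟩
    · simp [simpleWord_nil]
    · simp only [List.concat_eq_append, List.length_append, List.length_singleton] at hl
      obtain ⟨c, hc⟩ := exists_simpleWord_root b m i
      rw [List.concat_eq_append, simpleWord_append, simpleWord_singleton]
      by_cases hpos : b.IsPos c
      · rw [LinearEquiv.mul_apply, reflection_eq, map_sub (simpleWord b m),
          map_smul (simpleWord b m), hc, ← sub_add, map_add,
          map_smul]
        exact add_nonneg (ih _ (by omega) m rfl)
          (mul_nonneg (hdom i) (coord_root_nonneg b hpos k))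
      · obtain ⟨m', hm', h⟩ := hΦ.exists_shorter_simpleWord b i m hc hpos
        rw [h]
        exact ih _ (by omega) m' rfl

theorem IsEuclidean.coord_sub_nonneg [Finite ι] [Φ.IsRootSystem]
    [Φ.IsCrystallographic] [Φ.IsReduced]
    (hΦ : IsEuclidean Φ) (b : Φ.Base) {lam : V}
    (hdom : ∀ k : b.support, 0 ≤ Φ.toLinearMap lam (Φ.coroot k)) {v : V}
    (hv : v ∈ permutohedron Φ lam) (k : b.support) :
    0 ≤ b.toWeightBasis.coord k (lam - v) := by
  have h : permutohedron Φ lam ⊆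
      {v | b.toWeightBasis.coord k v ≤ b.toWeightBasis.coord k lam} := by
    refine convexHull_min ?_ (convex_halfSpace_le (b.toWeightBasis.coord k).isLinear _)
    rintro _ ⟨g, rfl⟩
    obtain ⟨l, hl⟩ := exists_smul_eq_simpleWord b g
    have := hΦ.coord_sub_simpleWord_nonneg b hdom k _ l rfl
    rw [← hl, map_sub, sub_nonneg] at this
    exact this
  rw [map_sub, sub_nonneg]
  exact h hv

theorem finite_orbit_weylGroup [Finite ι] [Φ.IsRootSystem] (b : Φ.Base) (v : V) :
    (MulAction.orbit Φ.weylGroup v).Finite := by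
  refine (Set.finite_range fun σ : Equiv.Perm ι =>
    ∑ k : b.support, b.toWeightBasis.coord k v • Φ.root (σ k)).subset ?_
  rintro _ ⟨g, rfl⟩
  refine ⟨Φ.weylGroupToPerm g, ?_⟩
  conv_rhs => rw [← sum_coord_smul_root b v]
  simp only [Finset.smul_sum, weylGroup_smul_real, Φ.weylGroup_apply_root]

/-- Take the orbit point with the largest coordinate sum: reflecting in a simple root with negative
pairing would increase that sum. -/
theorem IsEuclidean.exists_smul_dominant [Finite ι] [Φ.IsRootSystem] (hΦ : IsEuclidean Φ)
    (b : Φ.Base) (u : V) :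
    ∃ g : Φ.weylGroup, ∀ k : b.support, 0 ≤ inner ℝ (g • u) (Φ.root k) := by
  classical
  obtain ⟨_, ⟨g, rfl⟩, hg⟩ := (finite_orbit_weylGroup b u).exists_maximalFor
    (fun v => ∑ i, b.toWeightBasis.coord i v) _ ⟨u, MulAction.mem_orbit_self u⟩
  refine ⟨g, fun k => ?_⟩
  by_contra! hneg
  have hlt : Φ.toLinearMap (g • u) (Φ.coroot k) < 0 := by
    rw [hΦ]
    exact div_neg_of_neg_of_pos (by linarith) (inner_root_pos Φ _)
  have hs : ∑ i, b.toWeightBasis.coord i (RootPairing.weylGroup.ofIdx Φ k • g • u) =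
      ∑ i, b.toWeightBasis.coord i (g • u) - Φ.toLinearMap (g • u) (Φ.coroot k) := by
    simp only [ofIdx_smul_eq, map_sub, map_smul, coord_simpleRoot, Finset.sum_sub_distrib]
    simp
  have := hg (j := RootPairing.weylGroup.ofIdx Φ k • g • u)
    ⟨RootPairing.weylGroup.ofIdx Φ k * g, mul_smul _ _ _⟩
  simp only [hs] at this
  linarith [this (by linarith)]

/-- Separate `v` from the hull by a vector `u` and move `u` into the dominant chamber by `g`. If `λ
- gv` were a nonnegative combination of simple roots, `gu` would pair with `λ` at least as much as
with `gv`, against the separation. -/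
theorem IsEuclidean.exists_coord_sub_neg [Finite ι] [Φ.IsRootSystem] (hΦ : IsEuclidean Φ)
    (b : Φ.Base) {lam v : V} (hv : v ∉ permutohedron Φ lam) :
    ∃ (g : Φ.weylGroup) (k : b.support), b.toWeightBasis.coord k (lam - g • v) < 0 := by
  have : FiniteDimensional ℝ V := b.toWeightBasis.finiteDimensional_of_finite
  have : CompleteSpace V := FiniteDimensional.complete ℝ V
  obtain ⟨f, t, h1, h2⟩ := geometric_hahn_banach_closed_point (convex_convexHull ℝ _)
    ((finite_orbit_weylGroup b lam).isClosed_convexHull ℝ) hv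
  obtain ⟨u, rfl⟩ := (InnerProductSpace.toDual ℝ V).surjective f
  simp only [InnerProductSpace.toDual_apply_apply] at h1 h2
  obtain ⟨g, hg⟩ := hΦ.exists_smul_dominant b u
  refine ⟨g, ?_⟩
  by_contra! hk
  have h3 := h1 (g⁻¹ • lam) (subset_convexHull ℝ _ ⟨g⁻¹, rfl⟩)
  rw [← hΦ.inner_smul_smul g, smul_inv_smul] at h3
  rw [← hΦ.inner_smul_smul g] at h2
  have h4 : 0 ≤ inner ℝ (g • u) (lam - g • v) := by
    rw [← sum_coord_smul_root b (lam - g • v), inner_sum]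
    refine Finset.sum_nonneg fun k _ => ?_
    rw [real_inner_smul_right]
    exact mul_nonneg (hk k) (hg k)
  rw [inner_sub_right] at h4
  linarith

/-! ### Dominant weights -/

theorem dominantWeight_coroot [Φ.IsRootSystem] (b : Φ.Base) (c : b.support → ℕ)
    (k : b.support) : Φ.toLinearMap (dominantWeight b c) (Φ.coroot k) = c k := by
  classical
  rw [dominantWeight, map_sum, LinearMap.sum_apply]
  simp only [map_nsmul, LinearMap.smul_apply, fundamentalWeight_coroot]
  simp

theorem mem_weightLattice_of_simple [Φ.IsRootSystem] (b : Φ.Base) {v : V}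
    (hv : ∀ k : b.support, ∃ z : ℤ, Φ.toLinearMap v (Φ.coroot k) = z) :
    v ∈ weightLattice Φ := by
  intro a
  have h := b.coroot_mem_span_int a
  generalize Φ.coroot a = y at h ⊢
  induction h using Submodule.span_induction with
  | mem x hx =>
    obtain ⟨k, hk, rfl⟩ := hx
    exact hv ⟨k, hk⟩
  | zero => exact ⟨0, by simp⟩
  | add x y _ _ hx hy =>
    obtain ⟨p, hp⟩ := hx
    obtain ⟨q, hq⟩ := hy
    exact ⟨p + q, by simp [hp, hq]⟩
  | smul z x _ hx =>
    obtain ⟨p, hp⟩ := hx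
    exact ⟨z * p, by simp [hp]⟩

theorem dominantWeight_mem_weightLattice [Φ.IsRootSystem] (b : Φ.Base) (c : b.support → ℕ) :
    dominantWeight b c ∈ weightLattice Φ :=
  mem_weightLattice_of_simple b fun k => ⟨c k, by simp [dominantWeight_coroot]⟩

theorem exists_int_coord_of_mem_rootLattice [Φ.IsRootSystem] (b : Φ.Base) {v : V}
    (hv : v ∈ rootLattice Φ) (k : b.support) : ∃ z : ℤ, b.toWeightBasis.coord k v = z := by
  induction hv using AddSubgroup.closure_induction with
  | mem x hx =>
    obtain ⟨a, rfl⟩ := hx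
    obtain ⟨f, -, h, -⟩ := exists_int_coord_root b a
    exact ⟨f k, h k⟩
  | zero => exact ⟨0, by simp⟩
  | add x y _ _ hx hy =>
    obtain ⟨p, hp⟩ := hx
    obtain ⟨q, hq⟩ := hy
    exact ⟨p + q, by rw [map_add, hp, hq]; push_cast; rfl⟩
  | neg x _ hx =>
    obtain ⟨p, hp⟩ := hx
    exact ⟨-p, by rw [map_neg, hp]; push_cast; rfl⟩

/-- The coefficients of the coroot of a positive root with respect to the simple coroots. -/
theorem IsEuclidean.exists_nat_coroot [Φ.IsRootSystem] (hΦ : IsEuclidean Φ) (b : Φ.Base)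
    {a : ι} (ha : b.IsPos a) :
    ∃ n : b.support → ℕ,
      (∀ k, n k * inner ℝ (Φ.root a) (Φ.root a) =
        b.toWeightBasis.coord k (Φ.root a) * inner ℝ (Φ.root k) (Φ.root k)) ∧
      ∀ c : b.support → ℕ,
        Φ.toLinearMap (dominantWeight b c) (Φ.coroot a) = ∑ k, (c k : ℝ) * n k := by
  classical
  have h1 (k : b.support) : Φ.toLinearMap (fundamentalWeight b k) (Φ.coroot a) *
      inner ℝ (Φ.root a) (Φ.root a) =
        b.toWeightBasis.coord k (Φ.root a) * inner ℝ (Φ.root k) (Φ.root k) := by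
    rw [hΦ.apply_mul]
    conv_lhs => rw [← sum_coord_smul_root b (Φ.root a)]
    rw [inner_sum, Finset.mul_sum]
    have h (j : b.support) : 2 * inner ℝ (fundamentalWeight b k)
        (b.toWeightBasis.coord j (Φ.root a) • Φ.root j) =
        if k = j then b.toWeightBasis.coord k (Φ.root a) * inner ℝ (Φ.root k) (Φ.root k)
          else 0 := by
      rw [real_inner_smul_right, mul_left_comm, ← hΦ.apply_mul, fundamentalWeight_coroot]
      split_ifs with hkj
      · rw [hkj, one_mul]
      · simp
    simp only [h, Finset.sum_ite_eq, Finset.mem_univ, if_true]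
  have h2 (k : b.support) : ∃ n : ℕ,
      Φ.toLinearMap (fundamentalWeight b k) (Φ.coroot a) = n := by
    obtain ⟨z, hz⟩ := mem_weightLattice_of_simple b (v := fundamentalWeight b k)
      (fun j => ⟨if k = j then 1 else 0, by rw [fundamentalWeight_coroot]; split_ifs <;> simp⟩) a
    have h3 : (0 : ℝ) ≤ z := by
      rw [← hz]
      refine nonneg_of_mul_nonneg_left ?_ (inner_root_pos Φ a)
      rw [h1]
      exact mul_nonneg (coord_root_nonneg b ha k) (inner_root_pos Φ k).le
    lift z to ℕ using (by exact_mod_cast h3)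
    exact ⟨z, by simpa using hz⟩
  choose n hn using h2
  refine ⟨n, fun k => by rw [← hn, h1], fun c => ?_⟩
  rw [dominantWeight, map_sum, LinearMap.sum_apply]
  simp [hn]

/-! ### Orbits of roots -/

theorem exists_reflection_height_lt [Finite ι] [Φ.IsCrystallographic] [Φ.IsReduced]
    [Φ.IsRootSystem] (b : Φ.Base) {a : ι} (ha : b.IsPos a) (hs : a ∉ b.support) :
    ∃ j ∈ b.support, 0 < Φ.pairing a j ∧ b.IsPos (Φ.reflectionPerm j a) := by
  obtain ⟨j, hj, hj'⟩ := ha.exists_mem_support_pos_pairingIn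
  rw [Φ.zero_lt_pairingIn_iff'] at hj'
  refine ⟨j, hj, ?_, ha.reflectionPerm hj fun h => hs (h ▸ hj)⟩
  rw [← Φ.algebraMap_pairingIn ℤ, eq_intCast]
  exact_mod_cast hj'

/-- Every positive root is conjugate to a simple root in its support. -/
theorem exists_simpleRoot_mem_orbit_of_isPos [Finite ι] [Φ.IsCrystallographic] [Φ.IsReduced]
    [Φ.IsRootSystem] (b : Φ.Base) {a : ι} (ha : b.IsPos a) :
    ∃ k : b.support, 0 < b.toWeightBasis.coord k (Φ.root a) ∧
      Φ.root a ∈ MulAction.orbit Φ.weylGroup (Φ.root k) := by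
  -- Descend by simple reflections to a conjugate of least height, staying positive and never
  -- increasing a coordinate; it must be simple, and the bound on coordinates puts it in the support
  -- of `a`.
  classical
  obtain ⟨x, ⟨hx1, hx2, hx3⟩, hmin⟩ := (Set.toFinite {x | b.IsPos x ∧
      Φ.root a ∈ MulAction.orbit Φ.weylGroup (Φ.root x) ∧
      ∀ k, b.toWeightBasis.coord k (Φ.root x) ≤ b.toWeightBasis.coord k (Φ.root a)}
    ).exists_minimalFor b.height _ ⟨a, ha, MulAction.mem_orbit_self _, fun _ => le_rfl⟩
  by_cases hs : x ∈ b.support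
  · refine ⟨⟨x, hs⟩, lt_of_lt_of_le ?_ (hx3 _), hx2⟩
    have := coord_simpleRoot b ⟨x, hs⟩ ⟨x, hs⟩
    simp only [if_true] at this
    rw [this]
    exact one_pos
  · exfalso
    obtain ⟨j, hj, hpos, hpos'⟩ := exists_reflection_height_lt b hx1 hs
    have hroot : Φ.root (Φ.reflectionPerm j x) = Φ.root x - Φ.pairing x j • Φ.root j := by
      rw [Φ.root_reflectionPerm, Φ.reflection_apply_root]
    have hcoord (k : b.support) : b.toWeightBasis.coord k (Φ.root (Φ.reflectionPerm j x)) =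
        b.toWeightBasis.coord k (Φ.root x) - Φ.pairing x j * if k = ⟨j, hj⟩ then 1 else 0 := by
      rw [hroot, map_sub, map_smul, ← coord_simpleRoot]
      rfl
    have h := hmin (j := Φ.reflectionPerm j x) ⟨hpos', ?_, fun k => ?_⟩
    · have h1 := height_eq_sum_coord b (Φ.reflectionPerm j x)
      simp only [hcoord, Finset.sum_sub_distrib, ← height_eq_sum_coord] at h1
      simp only [mul_ite, mul_one, mul_zero, Finset.sum_ite_eq', Finset.mem_univ, if_true] at h1
      have h2 : b.height (Φ.reflectionPerm j x) < b.height x := by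
        have : (b.height (Φ.reflectionPerm j x) : ℝ) < b.height x := by linarith
        exact_mod_cast this
      exact absurd (h h2.le) (not_le.mpr h2)
    · have : Φ.root x = RootPairing.weylGroup.ofIdx Φ j • Φ.root (Φ.reflectionPerm j x) := by
        rw [RootPairing.weylGroup.ofIdx_smul, RootPairing.Equiv.reflection_smul,
          Φ.root_reflectionPerm]
        simp
      rwa [MulAction.orbit_eq_iff.mpr (⟨_, this.symm⟩ : Φ.root x ∈
        MulAction.orbit Φ.weylGroup (Φ.root (Φ.reflectionPerm j x)))] at hx2
    · rw [hcoord]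
      refine (sub_le_self _ ?_).trans (hx3 k)
      split_ifs <;> simp [hpos.le]

theorem exists_simpleRoot_mem_orbit [Finite ι] [Φ.IsCrystallographic] [Φ.IsReduced]
    [Φ.IsRootSystem] (b : Φ.Base) (a : ι) :
    ∃ k : b.support, Φ.root a ∈ MulAction.orbit Φ.weylGroup (Φ.root k) := by
  by_cases ha : b.IsPos a
  · obtain ⟨k, -, hk⟩ := exists_simpleRoot_mem_orbit_of_isPos b ha
    exact ⟨k, hk⟩
  · obtain ⟨k, -, g, hg⟩ := exists_simpleRoot_mem_orbit_of_isPos b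
      ((RootPairing.Base.IsPos.neg_iff_not b a).mpr ha)
    refine ⟨k, RootPairing.weylGroup.ofIdx Φ a * g, ?_⟩
    change (RootPairing.weylGroup.ofIdx Φ a * g) • Φ.root k = _
    change g • Φ.root k = _ at hg
    rw [mul_smul, hg, RootPairing.weylGroup.ofIdx_smul, RootPairing.Equiv.reflection_smul]
    simp

theorem IsEuclidean.inner_self_eq_of_mem_orbit (hΦ : IsEuclidean Φ) {u v : V}
    (h : u ∈ MulAction.orbit Φ.weylGroup v) : inner ℝ u u = inner ℝ v v := by
  obtain ⟨g, rfl⟩ := h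
  exact hΦ.inner_smul_smul g v v

theorem neg_root_mem_orbit (a : ι) :
    -Φ.root a ∈ MulAction.orbit Φ.weylGroup (Φ.root a) := by
  refine ⟨RootPairing.weylGroup.ofIdx Φ a, ?_⟩
  change RootPairing.weylGroup.ofIdx Φ a • Φ.root a = _
  rw [RootPairing.weylGroup.ofIdx_smul, RootPairing.Equiv.reflection_smul]
  simp

theorem root_mem_orbit_of_pairing_eq_one {a c : ι} (h1 : Φ.pairing a c = 1)
    (h2 : Φ.pairing c a = 1) : Φ.root a ∈ MulAction.orbit Φ.weylGroup (Φ.root c) := by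
  have e (x : ι) (v : V) : RootPairing.weylGroup.ofIdx Φ x • v = Φ.reflection x v := rfl
  refine ⟨RootPairing.weylGroup.ofIdx Φ a * (RootPairing.weylGroup.ofIdx Φ c *
    RootPairing.weylGroup.ofIdx Φ a), ?_⟩
  change (RootPairing.weylGroup.ofIdx Φ a * (RootPairing.weylGroup.ofIdx Φ c *
    RootPairing.weylGroup.ofIdx Φ a)) • Φ.root c = _
  rw [mul_smul, mul_smul, e, e, e]
  simp only [Φ.reflection_apply_root, map_sub, map_smul, h1, h2, Φ.pairing_same]
  module

/-- By irreducibility the orbit of `c` spans `V`, so some conjugate `d` is not orthogonal to `a`.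
Two nonorthogonal roots of equal length are equal, opposite, or have both pairings `1` or both `-1`;
each case gives explicit reflections carrying `d` to `a`. -/
theorem IsEuclidean.root_mem_orbit_of_inner_self_eq [Finite ι] [Φ.IsCrystallographic]
    [Φ.IsReduced] [Φ.IsIrreducible] (hΦ : IsEuclidean Φ) {a c : ι}
    (h : inner ℝ (Φ.root a) (Φ.root a) = inner ℝ (Φ.root c) (Φ.root c)) :
    Φ.root a ∈ MulAction.orbit Φ.weylGroup (Φ.root c) := by
  obtain ⟨g, hg⟩ : ∃ g : Φ.weylGroup, inner ℝ (Φ.root a) (g • Φ.root c) ≠ 0 := by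
    by_contra! contra
    suffices Submodule.span ℝ (MulAction.orbit Φ.weylGroup (Φ.root c)) ≤
        LinearMap.ker (innerₗ V (Φ.root a)) by
      rw [Φ.span_orbit_eq_top] at this
      exact (inner_root_pos Φ a).ne' (this (Submodule.mem_top (x := Φ.root a)))
    refine Submodule.span_le.mpr ?_
    rintro _ ⟨g, rfl⟩
    exact contra g
  rw [Φ.weylGroup_apply_root] at hg
  set d := Φ.weylGroupToPerm g c
  have hdc : Φ.root d ∈ MulAction.orbit Φ.weylGroup (Φ.root c) :=
    ⟨g, Φ.weylGroup_apply_root g c⟩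
  rw [← MulAction.orbit_eq_iff.mpr hdc]
  rw [← hΦ.inner_self_eq_of_mem_orbit hdc] at h
  have hne : Φ.pairing a d ≠ 0 := fun h0 =>
    hg ((hΦ.form.apply_root_root_zero_iff a d).mpr h0)
  by_cases h1 : a = d
  · rw [h1]; exact MulAction.mem_orbit_self _
  by_cases h2 : Φ.root a = -Φ.root d
  · rw [h2]; exact neg_root_mem_orbit d
  have hmem := Φ.pairingIn_pairingIn_mem_set_of_length_eq_of_ne (B := hΦ.form) h h1 h2
  rw [← Φ.algebraMap_pairingIn ℤ] at hne
  have hne : Φ.pairingIn ℤ a d ≠ 0 := fun h0 => hne (by rw [h0, map_zero])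
  simp only [Set.mem_insert_iff, Set.mem_singleton_iff, Prod.mk.injEq] at hmem
  rcases hmem with h3 | h3 | h3
  · exact absurd h3.1 hne
  · refine root_mem_orbit_of_pairing_eq_one ?_ ?_ <;> rw [← Φ.algebraMap_pairingIn ℤ] <;>
      simp [h3]
  · let := Φ.indexNeg
    have h4 : Φ.root a ∈ MulAction.orbit Φ.weylGroup (Φ.root (-d)) := by
      refine root_mem_orbit_of_pairing_eq_one ?_ ?_ <;> rw [← Φ.algebraMap_pairingIn ℤ] <;>
        simp [h3]
    simp only [Φ.indexNeg_neg, Φ.root_reflectionPerm, Φ.reflection_apply_self] at h4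
    rwa [MulAction.orbit_eq_iff.mpr (neg_root_mem_orbit d)] at h4

/-! ### Reduction to an antidominant root -/

/-- Among all Weyl translates of `μ + α` that violate some coordinate inequality, choose one whose
translate `x` of `α` has least height. The sign conditions on `x` then make all but one term of `⟨λ
- ν, x^∨⟩` controllable. -/
theorem IsEuclidean.exists_antidominant [Finite ι] [Φ.IsRootSystem]
    [Φ.IsCrystallographic] [Φ.IsReduced]
    (hΦ : IsEuclidean Φ) (b : Φ.Base) {lam μ : V} {a : ι} (hlam : lam ∈ weightLattice Φ)
    (hdom : ∀ k : b.support, 0 ≤ Φ.toLinearMap lam (Φ.coroot k))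
    (h1 : μ ∈ discretePermutohedron Φ lam) (h2 : μ + Φ.root a ∉ discretePermutohedron Φ lam) :
    ∃ (ν : V) (x : ι) (i : b.support), ν ∈ discretePermutohedron Φ lam ∧
      Φ.root x ∈ MulAction.orbit Φ.weylGroup (Φ.root a) ∧
      Φ.toLinearMap ν (Φ.coroot x) = Φ.toLinearMap μ (Φ.coroot a) ∧
      b.toWeightBasis.coord i (lam - ν) < b.toWeightBasis.coord i (Φ.root x) ∧
      ∀ k, k ≠ i → Φ.pairing k x ≤ 0 ∧
        b.toWeightBasis.coord k (Φ.root x) ≤ b.toWeightBasis.coord k (lam - ν) := by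
  classical
  have h2' : μ + Φ.root a ∉ permutohedron Φ lam := by
    refine fun h => h2 ⟨h, ?_⟩
    rw [add_sub_right_comm]
    exact add_mem h1.2 (AddSubgroup.subset_closure (Set.mem_range_self a))
  obtain ⟨g₀, i₀, h0⟩ := hΦ.exists_coord_sub_neg b h2'
  obtain ⟨x, ⟨g, i, hx, hi⟩, hmin⟩ := (Set.toFinite {x | ∃ (g : Φ.weylGroup) (i : b.support),
      Φ.weylGroupToPerm g a = x ∧ b.toWeightBasis.coord i (lam - g • (μ + Φ.root a)) < 0}
    ).exists_minimalFor b.height _ ⟨_, g₀, i₀, rfl, h0⟩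
  have hgx : g • Φ.root a = Φ.root x := by rw [Φ.weylGroup_apply_root, hx]
  -- Reflecting in `α_k` leaves coordinate `j ≠ k` and its violation unchanged, but would lower the
  -- height of `x` if `⟨x, α_k⟩ > 0`.
  have hstep (j k : b.support) (hjk : k ≠ j)
      (hj : b.toWeightBasis.coord j (lam - g • (μ + Φ.root a)) < 0) :
      inner ℝ (Φ.root k) (Φ.root x) ≤ 0 := by
    by_contra! hpos
    set s := RootPairing.weylGroup.ofIdx Φ k
    set x' := Φ.weylGroupToPerm (s * g) a
    have hx' : Φ.root x' = Φ.root x - Φ.pairing x k • Φ.root k := by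
      rw [← Φ.weylGroup_apply_root, mul_smul, hgx, ofIdx_smul_eq, Φ.root_coroot_eq_pairing]
    have hp : 0 < Φ.pairing x k := by
      rw [← Φ.root_coroot_eq_pairing, hΦ, real_inner_comm]
      exact div_pos (by linarith) (inner_root_pos Φ k)
    have h3 := height_eq_sum_coord b x'
    simp only [hx', map_sub, map_smul, Finset.sum_sub_distrib, ← height_eq_sum_coord,
      coord_simpleRoot] at h3
    simp only [smul_eq_mul, mul_ite, mul_one, mul_zero, Finset.sum_ite_eq', Finset.mem_univ,
      if_true] at h3
    have h4 : b.height x' < b.height x := by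
      have : (b.height x' : ℝ) < b.height x := by linarith
      exact_mod_cast this
    refine absurd (hmin (j := x') ⟨s * g, j, rfl, ?_⟩ h4.le) (not_le.mpr h4)
    rw [mul_smul, ofIdx_smul_eq, ← sub_add, map_add, map_smul, coord_simpleRoot,
      if_neg hjk.symm]
    simpa using hj
  have hcoord (k : b.support) : b.toWeightBasis.coord k (lam - g • (μ + Φ.root a)) =
      b.toWeightBasis.coord k (lam - g • μ) - b.toWeightBasis.coord k (Φ.root x) := by
    rw [smul_add, hgx, ← sub_sub, map_sub]
  have hν := smul_mem_discretePermutohedron hlam g h1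
  have hi' : b.toWeightBasis.coord i (lam - g • μ) < b.toWeightBasis.coord i (Φ.root x) := by
    rw [hcoord] at hi; linarith
  have hxpos : b.IsPos x := isPos_of_coord_pos b
    ((hΦ.coord_sub_nonneg b hdom hν.1 i).trans_lt hi')
  refine ⟨g • μ, x, i, hν, ⟨g, hgx⟩, ?_, hi', fun k hk => ⟨?_, ?_⟩⟩
  · rw [← hx]; exact hΦ.apply_smul_coroot g μ a
  · rw [← Φ.root_coroot_eq_pairing, hΦ]
    exact div_nonpos_of_nonpos_of_nonneg (by linarith [hstep i k hk hi]) (inner_root_pos Φ x).le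
  -- With two violated coordinates, `hstep` covers every simple root; then the positive root `x`
  -- would satisfy `⟨x, x⟩ ≤ 0`.
  · by_contra! hlt
    have hall (j : b.support) : inner ℝ (Φ.root j) (Φ.root x) ≤ 0 := by
      by_cases hji : j = i
      · exact hstep k j (hji ▸ hk.symm) (by rw [hcoord]; linarith)
      · exact hstep i j hji hi
    have h5 : inner ℝ (Φ.root x) (Φ.root x) ≤ 0 := by
      conv_lhs => enter [2]; rw [← sum_coord_smul_root b (Φ.root x)]
      rw [sum_inner]
      refine Finset.sum_nonpos fun j _ => ?_
      rw [real_inner_smul_left]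
      exact mul_nonpos_of_nonneg_of_nonpos (coord_root_nonneg b hxpos j) (hall j)
    exact absurd h5 (not_le.mpr (inner_root_pos Φ x))

/-! ### Upper bounds for traverse lengths -/

theorem sub_root_mem_discretePermutohedron [Φ.IsCrystallographic] {lam u : V} {a : ι}
    (hlam : lam ∈ weightLattice Φ) (hu : u ∈ discretePermutohedron Φ lam)
    (h : 0 < Φ.toLinearMap u (Φ.coroot a)) : u - Φ.root a ∈ discretePermutohedron Φ lam := by
  obtain ⟨z, hz⟩ := mem_weightLattice_of_mem_discretePermutohedron hlam hu a
  have hs := smul_mem_discretePermutohedron hlam (RootPairing.weylGroup.ofIdx Φ a) hu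
  rw [ofIdx_smul_eq, hz, Int.cast_smul_eq_zsmul] at hs
  rw [hz] at h
  have h : 0 < z := by exact_mod_cast h
  have := sub_zsmul_mem_discretePermutohedron (x := 0) (y := 1) (by simpa using hu) hs
    (by omega) (by omega)
  simpa using this

theorem IsEuclidean.mem_traverseLengths [Φ.IsCrystallographic] (hΦ : IsEuclidean Φ)
    {lam μ : V} {a k : ι} {ℓ : ℕ} (hlam : lam ∈ weightLattice Φ)
    (ha : Φ.root a ∈ MulAction.orbit Φ.weylGroup (Φ.root k))
    (h1 : μ ∈ discretePermutohedron Φ lam) (h2 : μ + Φ.root k ∉ discretePermutohedron Φ lam)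
    (h3 : Φ.toLinearMap μ (Φ.coroot k) = ℓ) : ℓ ∈ traverseLengths Φ lam a := by
  obtain ⟨g, hg⟩ := ha
  change g • Φ.root k = Φ.root a at hg
  have hga : Φ.weylGroupToPerm g k = a := by
    rw [Φ.weylGroup_apply_root] at hg
    exact Φ.root.injective hg
  rw [← smul_mem_discretePermutohedron_iff hlam g, smul_add, hg] at h2
  obtain ⟨ℓ', hℓ', ht⟩ := exists_isTraverse hlam (smul_mem_discretePermutohedron hlam g h1) h2
  rw [← hga, hΦ.apply_smul_coroot, h3] at hℓ'
  obtain rfl : ℓ = ℓ' := by exact_mod_cast hℓ'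
  exact ⟨_, ht⟩

theorem IsEuclidean.add_simpleRoot_notMem [Finite ι] [Φ.IsRootSystem] [Φ.IsCrystallographic]
    [Φ.IsReduced] (hΦ : IsEuclidean Φ) (b : Φ.Base) (c : b.support → ℕ) (k : b.support) :
    dominantWeight b c + Φ.root k ∉ discretePermutohedron Φ (dominantWeight b c) := by
  classical
  intro h
  have := hΦ.coord_sub_nonneg b
    (fun k => by rw [dominantWeight_coroot]; positivity) h.1 k
  rw [sub_add_cancel_left, map_neg, coord_simpleRoot, if_pos rfl] at this
  norm_num at this

theorem IsEuclidean.conjugateCoeffs_subset [Finite ι] [Φ.IsRootSystem] [Φ.IsCrystallographic]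
    [Φ.IsReduced] (hΦ : IsEuclidean Φ) (b : Φ.Base) (c : b.support → ℕ) (a : ι) :
    conjugateCoeffs b c a ⊆ traverseLengths Φ (dominantWeight b c) a := by
  rintro _ ⟨k, hk, rfl⟩
  exact hΦ.mem_traverseLengths (dominantWeight_mem_weightLattice b c) hk
    (self_mem_discretePermutohedron _) (hΦ.add_simpleRoot_notMem b c k)
    (dominantWeight_coroot b c k)

theorem inner_self_le_of_isLong {a : ι} (ha : IsLong Φ a) (x : ι) :
    inner ℝ (Φ.root x) (Φ.root x) ≤ inner ℝ (Φ.root a) (Φ.root a) := by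
  rw [real_inner_self_eq_norm_sq, real_inner_self_eq_norm_sq]
  exact pow_le_pow_left₀ (norm_nonneg _) (ha x) 2

theorem isLong_of_inner_self_le {a : ι}
    (h : ∀ x, inner ℝ (Φ.root x) (Φ.root x) ≤ inner ℝ (Φ.root a) (Φ.root a)) :
    IsLong Φ a := by
  intro x
  have := h x
  rw [real_inner_self_eq_norm_sq, real_inner_self_eq_norm_sq] at this
  exact le_of_sq_le_sq this (norm_nonneg _)

theorem IsLong.inner_self_lt {l s : ι} (hl : IsLong Φ l) (hs : ¬ IsLong Φ s) :
    inner ℝ (Φ.root s) (Φ.root s) < inner ℝ (Φ.root l) (Φ.root l) := by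
  by_contra! h
  exact hs (isLong_of_inner_self_le fun x => (inner_self_le_of_isLong hl x).trans h)

theorem IsLong.inner_self_eq {a c : ι} (ha : IsLong Φ a) (hc : IsLong Φ c) :
    inner ℝ (Φ.root a) (Φ.root a) = inner ℝ (Φ.root c) (Φ.root c) :=
  le_antisymm (inner_self_le_of_isLong hc a) (inner_self_le_of_isLong ha c)

theorem pairing_eq_intCast [Φ.IsCrystallographic] (a c : ι) :
    Φ.pairing a c = (Φ.pairingIn ℤ a c : ℝ) := by
  rw [← Φ.algebraMap_pairingIn ℤ, eq_intCast]

theorem IsEuclidean.pairing_mul_inner_self (hΦ : IsEuclidean Φ) (a c : ι) :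
    Φ.pairing c a * inner ℝ (Φ.root a) (Φ.root a) =
      Φ.pairing a c * inner ℝ (Φ.root c) (Φ.root c) :=
  hΦ.form.pairing_mul_eq_pairing_mul_swap a c

/-- The length `c_l - 1` is attained when `λ` is funny. -/
theorem IsEuclidean.pred_mem_traverseLengths [Finite ι] [Φ.IsRootSystem] [Φ.IsCrystallographic]
    [Φ.IsReduced] (hΦ : IsEuclidean Φ) (b : Φ.Base) (c : b.support → ℕ) {a : ι}
    {l s : b.support} (ha : Φ.root a ∈ MulAction.orbit Φ.weylGroup (Φ.root l))
    (hl : IsLong Φ l) (hs : ¬ IsLong Φ s) (hls : Φ.pairing l s ≠ 0) (hcs : c s = 0)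
    (hcl : 1 ≤ c l) : c l - 1 ∈ traverseLengths Φ (dominantWeight b c) a := by
  set lam := dominantWeight b c
  have hlam := dominantWeight_mem_weightLattice b c
  have hne : (l : ι) ≠ s := fun h => hs (h ▸ hl)
  have hlt := hl.inner_self_lt hs
  have hmul := hΦ.pairing_mul_inner_self s l
  have h1 : Φ.pairingIn ℤ l s ≤ 0 := b.pairingIn_le_zero_of_ne hne l.2 s.2
  have h2 : Φ.pairingIn ℤ l s ≠ 0 := fun h => hls (by rw [pairing_eq_intCast, h]; simp)
  have hpos : 0 < inner ℝ (Φ.root s) (Φ.root s) := inner_root_pos Φ s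
  -- Because `α_l` is longer, `⟨α_s, α_l^∨⟩` is the smaller of the two negative pairings in absolute
  -- value; the rank-two list leaves only `-1`.
  have hsl : Φ.pairing s l = -1 := by
    have hmem := Φ.pairingIn_pairingIn_mem_set_of_isCrystal_of_isRed s l
    rw [pairing_eq_intCast, pairing_eq_intCast] at hmul
    rw [pairing_eq_intCast]
    simp only [Set.mem_insert_iff, Set.mem_singleton_iff, Prod.mk.injEq] at hmem
    have key : Φ.pairingIn ℤ s l = -1 := by
      rcases hmem with h | h | h | h | h | h | h | h | h | h | h | h | h <;>
        first
        | exact h.1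
        | omega
        | (rw [h.1, h.2] at hmul; push_cast at hmul; linarith)
    rw [key]; norm_num
  have hls' : Φ.pairing l s < 0 := by
    rw [pairing_eq_intCast]; exact_mod_cast lt_of_le_of_ne h1 h2
  have m1 : lam - Φ.root l ∈ discretePermutohedron Φ lam :=
    sub_root_mem_discretePermutohedron hlam (self_mem_discretePermutohedron _)
      (by rw [dominantWeight_coroot]; exact_mod_cast hcl)
  have m2 : lam - Φ.root l - Φ.root s ∈ discretePermutohedron Φ lam := by
    refine sub_root_mem_discretePermutohedron hlam m1 ?_
    rw [map_sub, LinearMap.sub_apply, dominantWeight_coroot, hcs, Φ.root_coroot_eq_pairing]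
    simpa using hls'
  refine hΦ.mem_traverseLengths hlam ha m2 ?_ ?_
  -- As `c_s = 0`, the reflection `s_s` fixes `λ` and sends `λ - α_s` to `λ + α_s`, which is
  -- outside.
  · have h3 : RootPairing.weylGroup.ofIdx Φ s • (lam - Φ.root l - Φ.root s + Φ.root l) =
        lam + Φ.root s := by
      rw [ofIdx_smul_eq]
      simp only [map_sub, map_add, LinearMap.sub_apply, LinearMap.add_apply, lam,
        dominantWeight_coroot, hcs, Φ.root_coroot_eq_pairing, Φ.pairing_same]
      push_cast
      module
    rw [← smul_mem_discretePermutohedron_iff hlam (RootPairing.weylGroup.ofIdx Φ s), h3]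
    exact hΦ.add_simpleRoot_notMem b c s
  · simp only [map_sub, LinearMap.sub_apply, lam, dominantWeight_coroot,
      Φ.root_coroot_eq_pairing, Φ.pairing_same, hsl]
    push_cast [hcl]
    ring

/-! ### The lower bound -/

theorem sum_coord_mul_pairing [Φ.IsRootSystem] (b : Φ.Base) (v : V) (x : ι) :
    Φ.toLinearMap v (Φ.coroot x) = ∑ k, b.toWeightBasis.coord k v * Φ.pairing k x := by
  conv_lhs => rw [← sum_coord_smul_root b v]
  rw [map_sum, LinearMap.sum_apply]
  simp

/-- Here `r` and `n` are the coefficients of `x` and `x^∨` in simple roots and coroots. With `y` the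
coordinates of `λ - ν`, one has `ℓ = ∑ c_k n_k - ∑ y_k ⟨α_k, x^∨⟩`, so the task is to bound the last
sum from above. -/
theorem IsEuclidean.exists_bounds [Finite ι] [Φ.IsRootSystem]
    [Φ.IsCrystallographic] [Φ.IsReduced]
    (hΦ : IsEuclidean Φ) (b : Φ.Base) (c : b.support → ℕ) {μ : V} {a : ι} {ℓ : ℕ}
    (h : IsTraverse Φ (dominantWeight b c) a μ ℓ) :
    ∃ (x : ι) (i : b.support) (n r : b.support → ℕ) (p : ℤ), b.IsPos x ∧
      Φ.root x ∈ MulAction.orbit Φ.weylGroup (Φ.root a) ∧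
      (∀ k, b.toWeightBasis.coord k (Φ.root x) = r k) ∧
      (∀ k, n k * inner ℝ (Φ.root x) (Φ.root x) = r k * inner ℝ (Φ.root k) (Φ.root k)) ∧
      Φ.pairing i x = p ∧ 1 ≤ p ∧ 0 < r i ∧
      ((∑ k, c k * n k : ℕ) : ℤ) - 2 + p ≤ ℓ ∧
      (r i = 1 → ∑ k, c k * n k ≤ ℓ) := by
  have hlam := dominantWeight_mem_weightLattice b c
  have hdom (k : b.support) : 0 ≤ Φ.toLinearMap (dominantWeight b c) (Φ.coroot k) := by
    rw [dominantWeight_coroot]; positivity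
  obtain ⟨h1, hd⟩ := h.apply_coroot hlam
  obtain ⟨ν, x, i, hν, hx, hνx, hi, hk⟩ := hΦ.exists_antidominant b hlam hdom h1 h.2.2.1
  have hy (k : b.support) := hΦ.coord_sub_nonneg b hdom hν.1 k
  have hxpos : b.IsPos x := isPos_of_coord_pos b ((hy i).trans_lt hi)
  obtain ⟨n, hn, hS⟩ := hΦ.exists_nat_coroot b hxpos
  obtain ⟨r, hr, -⟩ := exists_nat_coord_root b hxpos
  obtain ⟨z, hz⟩ := exists_int_coord_of_mem_rootLattice b (neg_mem hν.2) i
  rw [neg_sub] at hz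
  have hz0 : 0 ≤ z := by
    have := hy i
    rw [hz] at this
    exact_mod_cast this
  rw [hr, hz] at hi
  have hzr : z < r i := by exact_mod_cast hi
  have hd' : (ℓ : ℝ) = ∑ k, (c k : ℝ) * n k -
      ∑ k, b.toWeightBasis.coord k (dominantWeight b c - ν) * Φ.pairing k x := by
    rw [← hS, ← sum_coord_mul_pairing, map_sub, LinearMap.sub_apply, hνx, hd]
    ring
  have h2 : (2 : ℝ) = ∑ k, b.toWeightBasis.coord k (Φ.root x) * Φ.pairing k x := by
    rw [← sum_coord_mul_pairing, Φ.root_coroot_eq_pairing, Φ.pairing_same]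
  -- a sum with nonpositive terms off `i` is at most its term at `i`
  have hsum (f : b.support → ℝ) (hf : ∀ k, k ≠ i → f k ≤ 0) : ∑ k, f k ≤ f i := by
    classical
    rw [← Finset.add_sum_erase _ _ (Finset.mem_univ i)]
    have : ∑ k ∈ Finset.univ.erase i, f k ≤ 0 :=
      Finset.sum_nonpos fun k hk => hf k (Finset.ne_of_mem_erase hk)
    linarith
  have hB0 : (2 : ℝ) ≤ r i * Φ.pairing i x := by
    rw [h2, ← hr]
    exact hsum (fun k => b.toWeightBasis.coord k (Φ.root x) * Φ.pairing k x) fun k hki =>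
      mul_nonpos_of_nonneg_of_nonpos (coord_root_nonneg b hxpos k) (hk k hki).1
  have hB1 := hsum
    (fun k => b.toWeightBasis.coord k (dominantWeight b c - ν) * Φ.pairing k x) fun k hki =>
      mul_nonpos_of_nonneg_of_nonpos (hy k) (hk k hki).1
  -- Using `y - r` in place of `y` and `∑ r_k ⟨α_k, x^∨⟩ = 2` gives `∑ y_k ⟨α_k, x^∨⟩ ≤ 2 - (r_i -
  -- y_i)p`, where `r_i - y_i ≥ 1` by integrality.
  have hB2 := hsum
    (fun k => (b.toWeightBasis.coord k (dominantWeight b c - ν) -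
      b.toWeightBasis.coord k (Φ.root x)) * Φ.pairing k x) fun k hki =>
      mul_nonpos_of_nonneg_of_nonpos (sub_nonneg.mpr (hk k hki).2) (hk k hki).1
  simp only [sub_mul, Finset.sum_sub_distrib, ← h2] at hB2
  simp only [hz, hr, pairing_eq_intCast] at hB0 hB1 hB2
  set p := Φ.pairingIn ℤ i x
  have hB0' : (2 : ℤ) ≤ r i * p := by exact_mod_cast hB0
  have hp : 1 ≤ p := by
    by_contra! hp
    nlinarith [mul_nonneg (Int.natCast_nonneg (r i)) (show (0 : ℤ) ≤ -p by omega)]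
  refine ⟨x, i, n, r, p, hxpos, hx, hr, fun k => by rw [hn, hr], pairing_eq_intCast _ _, hp,
    by omega, ?_, fun hri => ?_⟩
  · have h3 : (p : ℝ) ≤ (r i - z) * p := by
      have : p ≤ (r i - z) * p := le_mul_of_one_le_left (by omega) (by omega)
      exact_mod_cast this
    have h4 : ((∑ k, c k * n k : ℕ) : ℝ) - 2 + p ≤ ℓ := by
      push_cast
      simp only [pairing_eq_intCast] at hd'
      linarith
    exact_mod_cast h4
  -- Here `0 ≤ z < r_i = 1`, so the term at `i` vanishes and `hB1` bounds the whole sum by `0`.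
  · obtain rfl : z = 0 := by omega
    have h4 : ((∑ k, c k * n k : ℕ) : ℝ) ≤ ℓ := by
      push_cast
      simp only [pairing_eq_intCast] at hd'
      simp only [Int.cast_zero, zero_mul] at hB1
      linarith
    exact_mod_cast h4

/-- If `ℓ < m`, then `S - 2 + p ≤ ℓ < m ≤ S` with `p ≥ 1` leaves no slack: `p = 1`, `S = m` and `ℓ =
m - 1`. Tightness of `S = m` determines the support of `x` and the `c_k` on it. -/
theorem IsEuclidean.minCoeff_le [Finite ι] [Φ.IsRootSystem] [Φ.IsCrystallographic]
    [Φ.IsReduced] [Φ.IsIrreducible] (hΦ : IsEuclidean Φ) (b : Φ.Base) (c : b.support → ℕ)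
    {a : ι} {ℓ : ℕ} (hℓ : ℓ ∈ traverseLengths Φ (dominantWeight b c) a) :
    minCoeff b c a ≤ ℓ ∨ (IsLong Φ a ∧ IsFunny b c ∧ minCoeff b c a ≤ ℓ + 1) := by
  classical
  obtain ⟨μ, hμ⟩ := hℓ
  obtain ⟨x, i, n, r, p, hx, hxa, hr, hn, hip, hp, hri, hB2, hB1⟩ := hΦ.exists_bounds b c hμ
  by_cases hm : minCoeff b c a ≤ ℓ
  · exact Or.inl hm
  refine Or.inr ?_
  push Not at hm
  have hxx := inner_root_pos Φ x
  have hax : Φ.root a ∈ MulAction.orbit Φ.weylGroup (Φ.root x) :=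
    MulAction.mem_orbit_symm.mp hxa
  have hmin (k : b.support)
      (hk : inner ℝ (Φ.root k) (Φ.root k) = inner ℝ (Φ.root x) (Φ.root x)) :
      minCoeff b c a ≤ c k := by
    refine Nat.sInf_le ⟨k, ?_, rfl⟩
    rw [MulAction.orbit_eq_iff.mpr (hΦ.root_mem_orbit_of_inner_self_eq hk)]
    exact hax
  have hnr (k : b.support)
      (hk : inner ℝ (Φ.root k) (Φ.root k) = inner ℝ (Φ.root x) (Φ.root x)) : n k = r k := by
    have := hn k
    rw [hk] at this
    exact_mod_cast mul_right_cancel₀ hxx.ne' this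
  have hnpos (k : b.support) (hk : 0 < r k) : 0 < n k := by
    have h1 : (0 : ℝ) < n k * inner ℝ (Φ.root x) (Φ.root x) := by
      rw [hn]
      exact mul_pos (by exact_mod_cast hk) (inner_root_pos Φ k)
    exact_mod_cast pos_of_mul_pos_left h1 hxx.le
  obtain ⟨k₀, hk₀, hk₀x⟩ := exists_simpleRoot_mem_orbit_of_isPos b hx
  have hk₀x := (hΦ.inner_self_eq_of_mem_orbit hk₀x).symm
  rw [hr] at hk₀
  have hk₀ : 0 < r k₀ := by exact_mod_cast hk₀
  have hS1 : c k₀ * n k₀ ≤ ∑ k, c k * n k :=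
    Finset.single_le_sum (f := fun k => c k * n k) (fun _ _ => Nat.zero_le _)
      (Finset.mem_univ k₀)
  have hS2 (k : b.support) (hk : k ≠ k₀) : c k₀ * n k₀ + c k * n k ≤ ∑ k, c k * n k := by
    rw [← Finset.add_sum_erase _ _ (Finset.mem_univ k₀)]
    exact Nat.add_le_add_left (Finset.single_le_sum (f := fun k => c k * n k)
      (fun _ _ => Nat.zero_le _) (Finset.mem_erase.mpr ⟨hk, Finset.mem_univ k⟩)) _
  have hm₀ := hmin k₀ hk₀x
  have hn₀ := hnr k₀ hk₀x
  have hlow : minCoeff b c a ≤ c k₀ * n k₀ :=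
    hm₀.trans (Nat.le_mul_of_pos_right _ (hnpos k₀ hk₀))
  -- Otherwise `S ≥ 2m`, too large because `m > ℓ ≥ 0`.
  have hr₀ : r k₀ = 1 := by
    by_contra hne
    have : c k₀ * 2 ≤ c k₀ * n k₀ := Nat.mul_le_mul_left _ (by omega)
    omega
  have huniq (k : b.support) (hk : 0 < r k)
      (hkx : inner ℝ (Φ.root k) (Φ.root k) = inner ℝ (Φ.root x) (Φ.root x)) : k = k₀ := by
    by_contra hne
    have h1 := hS2 k hne
    have h2 := (hmin k hkx).trans (Nat.le_mul_of_pos_right _ (hnpos k hk))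
    omega
  have hik₀ : i ≠ k₀ := by
    rintro rfl
    have := hB1 hr₀
    omega
  have hix : inner ℝ (Φ.root i) (Φ.root i) ≠ inner ℝ (Φ.root x) (Φ.root x) :=
    fun h => hik₀ (huniq i hri h)
  obtain rfl : p = 1 := by omega
  -- Since `⟨α_i, x^∨⟩ = 1`, the ratio of squared lengths of `x` and `α_i` is the positive integer
  -- `⟨x, α_i^∨⟩`. As only two lengths occur, `x` is then long.
  have hlt : inner ℝ (Φ.root i) (Φ.root i) < inner ℝ (Φ.root x) (Φ.root x) := by
    have h1 := hΦ.pairing_mul_inner_self x i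
    rw [hip, pairing_eq_intCast x] at h1
    have hii := inner_root_pos Φ i
    have h2 : 0 < Φ.pairingIn ℤ x i := by
      have : (0 : ℝ) < Φ.pairingIn ℤ x i := by
        refine pos_of_mul_pos_left ?_ hii.le
        rw [← h1]
        simpa using hxx
      exact_mod_cast this
    refine lt_of_le_of_ne ?_ hix
    have h3 : (1 : ℝ) ≤ Φ.pairingIn ℤ x i := by exact_mod_cast h2
    have h4 := mul_le_mul_of_nonneg_right h3 hii.le
    rw [← h1] at h4
    simpa using h4
  have hlong {y : ι}
      (hy : inner ℝ (Φ.root y) (Φ.root y) = inner ℝ (Φ.root x) (Φ.root x)) : IsLong Φ y := by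
    refine isLong_of_inner_self_le fun z => ?_
    rw [hy]
    rcases hΦ.form.apply_eq_or_of_apply_ne hix z with h | h
    · exact (le_of_eq h).trans hlt.le
    · exact le_of_eq h
  have hxlong : IsLong Φ x := hlong rfl
  have hc₀ : c k₀ = minCoeff b c a := by
    rw [hn₀, hr₀] at hS1
    omega
  have hczero (k : b.support) (hk : 0 < r k) (hne : k ≠ k₀) : c k = 0 := by
    have h1 := hS2 k hne
    have h2 : c k * n k = 0 := by omega
    rcases Nat.mul_eq_zero.mp h2 with h | h
    · exact h
    · exact absurd h (hnpos k hk).ne'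
  -- If no other simple root in the support of `x` met `α_{k₀}`, then `⟨x, α_{k₀}^∨⟩ = 2`. For roots
  -- of equal length this forces proportionality, but `α_i` also occurs in `x`.
  obtain ⟨s, hsr, hsk, hsp⟩ : ∃ s : b.support, 0 < r s ∧ s ≠ k₀ ∧ Φ.pairing s k₀ ≠ 0 := by
    by_contra! contra
    have h1 : Φ.pairing x k₀ = 2 := by
      rw [← Φ.root_coroot_eq_pairing, sum_coord_mul_pairing b, Finset.sum_eq_single k₀]
      · rw [hr, hr₀, Φ.pairing_same]; norm_num
      · intro k _ hk
        rw [hr]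
        rcases Nat.eq_zero_or_pos (r k) with h0 | h0
        · rw [h0]; simp
        · rw [contra k h0 hk, mul_zero]
      · simp
    have hcoord : b.toWeightBasis.coord i (Φ.root k₀) = 0 := by
      rw [coord_simpleRoot, if_neg hik₀]
    have hri' : b.toWeightBasis.coord i (Φ.root x) ≠ 0 := by
      rw [hr]; exact_mod_cast hri.ne'
    have h2 := Φ.pairingIn_pairingIn_mem_set_of_length_eq_of_ne (B := hΦ.form) (i := x)
      (j := k₀) hk₀x.symm (fun h => hri' (by rw [h, hcoord]))
      (fun h => hri' (by rw [h, map_neg, hcoord, neg_zero]))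
    rw [pairing_eq_intCast] at h1
    have h1 : Φ.pairingIn ℤ x k₀ = 2 := by exact_mod_cast h1
    simp [h1] at h2
  have hk₀long : IsLong Φ k₀ := hlong hk₀x
  have hslong : ¬ IsLong Φ s := fun h => hsk (huniq s hsr (h.inner_self_eq hxlong))
  have hsp' : Φ.pairing k₀ s ≠ 0 := fun h => hsp (Φ.pairing_eq_zero_iff.mp h)
  refine ⟨hlong (hΦ.inner_self_eq_of_mem_orbit hax),
    ⟨fun hsl => ?_, k₀, s, hk₀long, hslong, hsp', hczero s hsr hsk, by omega,
      fun k hk => ?_⟩, by omega⟩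
  · rcases hsl k₀ s hsk.symm with h | h
    · rcases mul_eq_zero.mp h with h | h
      · exact hsp' h
      · exact hsp h
    · have h1 : Φ.pairing k₀ s * Φ.pairing s k₀ = 1 := h
      have h2 := hΦ.pairing_mul_inner_self s k₀
      have h3 : Φ.pairing k₀ s = Φ.pairing s k₀ := by
        rw [pairing_eq_intCast, pairing_eq_intCast] at h1 ⊢
        have h1 : Φ.pairingIn ℤ k₀ s * Φ.pairingIn ℤ s k₀ = 1 := by exact_mod_cast h1
        rcases Int.mul_eq_one_iff_eq_one_or_neg_one.mp h1 with h | h <;> rw [h.1, h.2]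
      rw [h3] at h2
      exact absurd (mul_left_cancel₀ hsp h2) (hk₀long.inner_self_lt hslong).ne
  · rw [hc₀]
    exact hmin k (hk.inner_self_eq hxlong)

end TraverseLength

end

theorem mainTheorem3 {ι V N : Type*} [Finite ι]
    [NormedAddCommGroup V] [InnerProductSpace ℝ V] [AddCommGroup N] [Module ℝ N]
    (Φ : RootPairing ι ℝ V N) [Φ.IsRootSystem] [Φ.IsCrystallographic] [Φ.IsReduced]
    [Φ.IsIrreducible] (hΦ : IsEuclidean Φ) (b : Φ.Base) (c : b.support → ℕ) (a : ι) :
    (traverseLengths Φ (dominantWeight b c) a).Nonempty ∧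
    (conjugateCoeffs b c a).Nonempty ∧
    (IsLong Φ a ∧ IsFunny b c →
      (traverseLength Φ (dominantWeight b c) a : ℤ) = (minCoeff b c a : ℤ) - 1) ∧
    (¬ (IsLong Φ a ∧ IsFunny b c) →
      traverseLength Φ (dominantWeight b c) a = minCoeff b c a) := by
  obtain ⟨k, hk⟩ := exists_simpleRoot_mem_orbit b a
  have hne : (conjugateCoeffs b c a).Nonempty := ⟨c k, k, hk, rfl⟩
  have hsub := hΦ.conjugateCoeffs_subset b c a
  have hne' := hne.mono hsub
  have hmem : traverseLength Φ (dominantWeight b c) a ∈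
    traverseLengths Φ (dominantWeight b c) a := Nat.sInf_mem hne'
  have hlow := hΦ.minCoeff_le b c hmem
  refine ⟨hne', hne, fun ⟨ha, hf⟩ => ?_, fun hf => ?_⟩
  · obtain ⟨-, l, s, hl, hs, hls, hcs, hcl, hall⟩ := hf
    have hal := hΦ.root_mem_orbit_of_inner_self_eq (ha.inner_self_eq hl)
    have h1 : traverseLength Φ (dominantWeight b c) a ≤ c l - 1 :=
      Nat.sInf_le (hΦ.pred_mem_traverseLengths b c hal hl hs hls hcs hcl)
    obtain ⟨i, hi, hci⟩ : minCoeff b c a ∈ conjugateCoeffs b c a := Nat.sInf_mem hne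
    -- The minimum is attained at a simple root conjugate to `α`, hence long, so funniness bounds it
    -- below by `c_l`.
    have h2 : c l ≤ minCoeff b c a := by
      rw [← hci]
      refine hall i (isLong_of_inner_self_le fun x => ?_)
      rw [← hΦ.inner_self_eq_of_mem_orbit hi]
      exact inner_self_le_of_isLong ha x
    have h3 : minCoeff b c a ≤ c l := Nat.sInf_le ⟨l, hal, rfl⟩
    omega
  · refine le_antisymm (Nat.sInf_le (hsub (Nat.sInf_mem hne))) ?_
    exact hlow.resolve_right fun h => hf ⟨h.1, h.2.1⟩
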